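/- An arena consists of a finite non-empty set $V$ of vertices partitioned into sets $V_0, V_1$ (the vertices of Player 0 and of Player 1), a set $E \subseteq V \times V$ of edges such that every vertex has an outgoing edge, a set $\mathbb{U}$ of labels, and a labeling $\lambda : E \to \mathbb{U}$, extended letter by letter to sequences of edges. A play is an infinite sequence $\pi = \pi_0 \pi_1 \cdots$ of vertices with $(\pi_j, \pi_{j+1}) \in E$ for all $j$. A strategy for Player $i$ is a function $S : V^* V_i \to V$ with $(v, S(uv)) \in E$ for all $u \in V^*$, $v \in V_i$; it is memoryless if $S(uv)$ depends only on $v$. A play $\pi$ is consistent with $S$ if $\pi_{j+1} = S(\pi_0 \cdots \pi_j)$ whenever $\pi_j \in V_i$. A game $(\mathcal{A}, O)$ is an arena with a set $O$ of plays; Player 0 wins the plays in $O$, and Player 1 wins the others. A strategy for Player $i$ is winning from $v$ if Player $i$ wins every play that starts in $v$ and is consistent with it; the winning region of Player $i$ is the set of vertices from which Player $i$ has a winning strategy. The game is uniform memoryless determined if the two winning regions partition $V$ and each player has a memoryless strategy that is winning from every vertex of that player's winning region. The cycles-decomposition $\mathrm{cycles}(\pi)$ of a play $\pi$ is the sequence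 of cycles output by the following procedure: start with an empty stack; at step $j$ push the edge $(\pi_j, \pi_{j+1})$, and if for some $k \ge 1$ the top $k$ edges on the stack form a cycle $(v_1,v_2)(v_2,v_3)\cdots(v_k,v_1)$, pop this cycle and output it. For $Y \subseteq \mathbb{U}^*$, let $\neg Y = \mathbb{U}^* \setminus Y$. The objective $O_{\mathrm{AC}(Y)}(\mathcal{A})$ of the all-cycles game of $Y$ is the set of plays $\pi$ such that $\lambda(u) \in Y$ for all cycles $u$ in $\mathrm{cycles}(\pi)$; the objective $O_{\mathrm{SAC}(Y)}(\mathcal{A})$ of the suffix all-cycles game of $Y$ is the set of plays that have some suffix $\pi'$ with $\lambda(u) \in Y$ for all cycles $u$ in $\mathrm{cycles}(\pi')$. For $W \subseteq \mathbb{U}^\omega$, let $O_W(\mathcal{A})$ be the set of plays $\pi$ with $\lambda(\pi_0,\pi_1)\lambda(\pi_1,\pi_2)\cdots \in W$. The winning condition $W$ is $Y$-greedy on $\mathcal{A}$ if $O_{\mathrm{AC}(Y)}(\mathcal{A}) \subseteq O_W(\mathcal{A})$ and $O_{\mathrm{AC}(\neg Y)}(\mathcal{A}) \cap O_W(\mathcal{A})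 = \emptyset$. **Corollary.** Let $Y \subseteq \mathbb{U}^*$ be closed under cyclic permutations ($ab \in Y$ implies $ba \in Y$ for all $a \in \mathbb{U}$, $b \in \mathbb{U}^*$), and let both $Y$ and $\neg Y$ be closed under concatenation ($a, b \in Y$ implies $ab \in Y$, and likewise for $\neg Y$). Then for every arena $\mathcal{A}$ with labels in $\mathbb{U}$ the following games are uniform memoryless determined: 1. $(\mathcal{A}, O_W(\mathcal{A}))$ for every $W \subseteq \mathbb{U}^\omega$ that is $Y$-greedy on $\mathcal{A}$; 2. the suffix all-cycles game $(\mathcal{A}, O_{\mathrm{SAC}(Y)}(\mathcal{A}))$; 3. the all-cycles game $(\mathcal{A}, O_{\mathrm{AC}(Y)}(\mathcal{A}))$. -/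

import Mathlib

namespace CycleGames

/-- An arena with vertex type `V` and labels in `U`. The two players are `0` and `1`, and
`owner v` is the player who moves at `v`: the sets `V₀ = {v | owner v = 0}` and
`V₁ = {v | owner v = 1}` are disjoint and cover `V`. There is an edge set without dead ends, and
edges (only) carry labels. -/
structure Arena (V U : Type*) where
  owner : V → Fin 2
  E : Set (V × V)
  no_dead_end : ∀ v, ∃ w, (v, w) ∈ E
  label : E → U

/-- Cycle properties: sets of finite words over `U`. -/
abbrev CycleProperty (U : Type*) := Set (List U)

/-- `ab ∈ Y` implies `ba ∈ Y` for every letter `a` and every word `b`. -/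
def ClosedUnderCyclicPerm {U : Type*} (Y : CycleProperty U) : Prop :=
  ∀ (a : U) (b : List U), a :: b ∈ Y → b ++ [a] ∈ Y

def ClosedUnderConcat {U : Type*} (Y : CycleProperty U) : Prop :=
  ∀ a b : List U, a ∈ Y → b ∈ Y → a ++ b ∈ Y

namespace Arena

variable {V U : Type*} (A : Arena V U)

/-- Plays: infinite sequences of vertices along the edges. -/
def Play := {π : ℕ → V // ∀ j, (π j, π (j + 1)) ∈ A.E}

variable {A}

/-- The `j`-th vertex of a play. -/
def Play.vertex (π : A.Play) (j : ℕ) : V := π.1 j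

/-- The `j`-th edge of a play. -/
def Play.edge (π : A.Play) (j : ℕ) : A.E := ⟨(π.1 j, π.1 (j + 1)), π.2 j⟩

/-- The suffix of a play that starts at position `n`. -/
def Play.suffix (π : A.Play) (n : ℕ) : A.Play :=
  ⟨fun j => π.1 (n + j), fun j => π.2 (n + j)⟩

/-! ### Strategies -/

variable (A) in
/-- A strategy for player `i`: for a history `uv` that ends in a vertex `v` of player `i`,
`move u v` is a successor of `v`. -/
structure Strategy (i : Fin 2) where
  move : List V → {v : V // A.owner v = i} → V
  legal : ∀ u v, (v.1, move u v) ∈ A.E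

def Strategy.Memoryless {i : Fin 2} (S : A.Strategy i) : Prop :=
  ∀ u u' v, S.move u v = S.move u' v

/-- A play `π` is consistent with a strategy of player `i` if `π (j + 1)` is the move of the strategy
after `π 0, …, π j`, whenever `π j` belongs to player `i`. -/
def Play.Consistent {i : Fin 2} (π : A.Play) (S : A.Strategy i) : Prop :=
  ∀ (j : ℕ) (h : A.owner (π.vertex j) = i),
    π.vertex (j + 1) = S.move ((List.range j).map π.vertex) ⟨π.vertex j, h⟩

/-! ### Games: a game is an arena with an objective, that is, a set of plays -/

/-- Player `0` wins the plays in the objective, player `1` wins the others. -/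
def WonBy (O : Set A.Play) (i : Fin 2) (π : A.Play) : Prop :=
  if i = 0 then π ∈ O else π ∉ O

def Strategy.WinningFrom {i : Fin 2} (S : A.Strategy i) (O : Set A.Play) (v : V) : Prop :=
  ∀ π : A.Play, π.vertex 0 = v → π.Consistent S → WonBy O i π

def winningRegion (O : Set A.Play) (i : Fin 2) : Set V :=
  {v | ∃ S : A.Strategy i, S.WinningFrom O v}

/-- The winning regions of the two players partition the vertices. -/
def Determined (O : Set A.Play) : Prop :=
  Disjoint (winningRegion O 0) (winningRegion O 1) ∧
    winningRegion O 0 ∪ winningRegion O 1 = Set.univ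

/-- One memoryless strategy of player `i` wins from every vertex of the winning region of
player `i`. -/
def UniformMemoryless (O : Set A.Play) (i : Fin 2) : Prop :=
  ∃ S : A.Strategy i, S.Memoryless ∧ ∀ v ∈ winningRegion O i, S.WinningFrom O v

def UniformMemorylessDetermined (O : Set A.Play) : Prop :=
  Determined O ∧ ∀ i, UniformMemoryless O i

/-! ### The cycles-decomposition of a play -/

/-- A cycle `(v₁,v₂)(v₂,v₃)⋯(vₖ,v₁)`, with `k ≥ 1`. -/
def IsCycle (u : List A.E) : Prop :=
  ∃ h : u ≠ [], u.IsChain (fun e f => e.1.2 = f.1.1) ∧ (u.getLast h).1.2 = (u.head h).1.1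

open Classical in
/-- One step of the decomposition. A stack is a list with its top at the head, so the top `k` edges
of `s`, in the order in which they were pushed, are `(s.take k).reverse`. The edge `e` is pushed; if
for some `k` the top `k` edges form a cycle, then this cycle is popped and output (for the least `k`;
the stacks that arise from a play allow at most one). The result is the new stack with the
output. -/
noncomputable def step (s : List A.E) (e : A.E) : List A.E × Option (List A.E) :=
  if h : ∃ k, IsCycle ((e :: s).take k).reverse then
    ((e :: s).drop (Nat.find h), some ((e :: s).take (Nat.find h)).reverse)
  else (e :: s, none)

/-- The stack before step `j`. -/
noncomputable def Play.stack (π : A.Play) : ℕ → List A.E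
  | 0 => []
  | j + 1 => (step (π.stack j) (π.edge j)).1

/-- The cycle output at step `j`, if there is one. -/
noncomputable def Play.output (π : A.Play) (j : ℕ) : Option (List A.E) :=
  (step (π.stack j) (π.edge j)).2

/-- The cycles that occur in the cycles-decomposition of `π`. -/
def Play.cycles (π : A.Play) : Set (List A.E) :=
  {u | ∃ j, π.output j = some u}

/-! ### Objectives -/

variable (A)

/-- The objective induced by a winning condition `W`, a set of infinite words over `U`. -/
def objective (W : Set (ℕ → U)) : Set A.Play :=
  {π | (fun j => A.label (π.edge j)) ∈ W}

/-- The objective of the all-cycles game of `Y`. -/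
def allCycles (Y : CycleProperty U) : Set A.Play :=
  {π | ∀ u ∈ π.cycles, u.map A.label ∈ Y}

/-- The objective of the suffix all-cycles game of `Y`. -/
def suffixAllCycles (Y : CycleProperty U) : Set A.Play :=
  {π | ∃ n, ∀ u ∈ (π.suffix n).cycles, u.map A.label ∈ Y}

variable {A}

/-- The game with objective `O` is `Y`-greedy. -/
def GreedyGame (Y : CycleProperty U) (O : Set A.Play) : Prop :=
  A.allCycles Y ⊆ O ∧ A.allCycles Yᶜ ⊆ Oᶜ

variable (A) in
/-- The winning condition `W` is `Y`-greedy on the arena `A`. -/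
def GreedyOn (Y : CycleProperty U) (W : Set (ℕ → U)) : Prop :=
  GreedyGame Y (A.objective W)

end Arena

end CycleGames

namespace CycleGames

/-! Player 0 plays for closed walks with word in `Y`, player 1 for closed walks with word in the
complement. It suffices to cover a finite graph by two regions, each with a positional strategy
under which every reachable closed walk suits its player (`nonempty_solution`): the cycles output
along any suffix of a consistent play are such walks.

The cover comes from induction on the number of edges. If a player has a choice at `v`, the edges at
`v` are split into two parts. If this player wins `v` in one part, that solution carries over.
Otherwise the opponent wins `v` in both parts and can combine the two strategies with one bit of
memory, recording the part of the edge last taken at `v`: between visits to `v` only one part is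
used, and concatenation handles closed factors at `v`. An opponent without choices needs no memory
for this.

If both players have choices and both splits end this way, the two memory strategies are played
against each other. The result has two cut vertices `v` and `w`; a recurring word `p` from `v` to
`w` gives closed words `pq` at `v` and `qp` at `w` of opposite kinds, against cyclic closure
(`false_of_two_cut_vertices`). Hence every vertex is won positionally by one of the players. -/

open Relation

/-! ### Words along sequences of vertices -/

section Words

variable {V U : Type*} {lab : V → V → U}

/-- The labels of the `n` steps of the sequence `x` that start at position `i`. -/
def word (lab : V → V → U) (x : ℕ → V) (i n : ℕ) : List U :=
  (List.range n).map fun k => lab (x (i + k)) (x (i + k + 1))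

theorem word_add (x : ℕ → V) (i m n : ℕ) :
    word lab x i (m + n) = word lab x i m ++ word lab x (i + m) n := by
  simp [word, List.range_add, add_assoc, Function.comp_def]

theorem word_congr {x y : ℕ → V} {i j n : ℕ} (h : ∀ k ≤ n, x (i + k) = y (j + k)) :
    word lab x i n = word lab y j n := by
  refine List.map_congr_left fun k hk => ?_
  have hk := List.mem_range.1 hk
  rw [h k hk.le, add_assoc, h (k + 1) hk, add_assoc]

theorem ClosedUnderCyclicPerm.append_comm {Z : CycleProperty U} (hZ : ClosedUnderCyclicPerm Z) :
    ∀ p q : List U, p ++ q ∈ Z → q ++ p ∈ Z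
  | [], q, h => by simpa using h
  | a :: p, q, h => by
    have := append_comm hZ p (q ++ [a]) (by simpa using hZ a (p ++ q) h)
    simpa using this

theorem ClosedUnderCyclicPerm.compl {Z : CycleProperty U} (hZ : ClosedUnderCyclicPerm Z) :
    ClosedUnderCyclicPerm Zᶜ :=
  fun a b h hb => h (by simpa using hZ.append_comm b [a] hb)

/-- Moving a window of one full period by one step moves its first letter to the end. -/
theorem word_rotate {Z : CycleProperty U} (hZ : ClosedUnderCyclicPerm Z) {x : ℕ → V} {i n : ℕ}
    (hx : ∀ k ≥ i, x (k + n) = x k) (h : word lab x i n ∈ Z) :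
    ∀ k ≥ i, word lab x k n ∈ Z := by
  intro k hk
  induction k, hk using Nat.le_induction with
  | base => exact h
  | succ k hk ih =>
    have h1 : word lab x k (1 + n) = word lab x k 1 ++ word lab x (k + 1) n := word_add ..
    have h2 : word lab x k (n + 1) = word lab x k n ++ word lab x (k + n) 1 := word_add ..
    have h3 : word lab x (k + n) 1 = word lab x k 1 := word_congr fun t _ => by
      rw [add_right_comm]; exact hx _ (by omega)
    rw [add_comm 1 n, h2, h3] at h1
    cases n with
    | zero => simpa [word] using ih
    | succ n =>
      rw [add_comm n 1, word_add] at ih h1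
      rw [List.append_assoc] at h1
      have h4 := List.append_cancel_left h1
      rw [add_comm n 1, ← h4]
      exact hZ.append_comm _ _ ih

theorem word_mul_mem {Z : CycleProperty U} (hcyc : ClosedUnderCyclicPerm Z)
    (hZ : ClosedUnderConcat Z) {x : ℕ → V} {i n : ℕ}
    (hx : ∀ k ≥ i, x (k + n) = x k) (h : word lab x i n ∈ Z) (m : ℕ) :
    ∀ k ≥ i, word lab x k ((m + 1) * n) ∈ Z := by
  induction m with
  | zero => simpa using word_rotate hcyc hx h
  | succ m ih =>
    intro k hk
    rw [add_mul (m + 1), word_add, one_mul]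
    exact hZ _ _ (ih k hk) (word_rotate hcyc hx h _ (by omega))

/-- Cut the factor at an intermediate visit to `v`; both pieces are shorter closed factors at `v`.
-/
theorem word_mem_of_endpoints {Z : CycleProperty U} (hZ : ClosedUnderConcat Z) {x : ℕ → V} {v : V}
    (hA : ∀ i n, 0 < n → x (i + n) = x i → (∀ k, i < k → k < i + n → x k ≠ v) →
      word lab x i n ∈ Z) (n : ℕ) :
    ∀ i, 0 < n → x i = v → x (i + n) = v → word lab x i n ∈ Z := by
  induction n using Nat.strong_induction_on with
  | _ n ih =>
    intro i hn hi hj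
    by_cases h : ∀ k, i < k → k < i + n → x k ≠ v
    · exact hA i n hn (hj.trans hi.symm) h
    · push Not at h
      obtain ⟨k, hik, hkn, hk⟩ := h
      obtain ⟨m, rfl⟩ := Nat.exists_eq_add_of_lt hik
      have h1 := ih (m + 1) (by omega) i (by omega) hi hk
      have h2 := ih (n - (m + 1)) (by omega) (i + m + 1) (by omega) hk
        (by rw [← hj]; congr 1; omega)
      have h3 : n = (m + 1) + (n - (m + 1)) := by omega
      rw [h3, word_add]
      exact hZ _ _ h1 h2

/-- Two cut vertices, each forcing the closed factors between its visits into one of two disjoint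
properties, cannot coexist: this is the case where one of them is visited finitely often. -/
theorem false_of_finitely_often [Finite V] {Z₁ Z₂ : CycleProperty U}
    (hd : ∀ u, u ∈ Z₁ → u ∉ Z₂) (hZ₂ : ClosedUnderConcat Z₂) {x : ℕ → V} {v w : V}
    (hA : ∀ i n, 0 < n → x (i + n) = x i → (∀ k, i < k → k < i + n → x k ≠ v) →
      word lab x i n ∈ Z₁)
    (hB : ∀ i n, 0 < n → x (i + n) = x i → (∀ k, i < k → k < i + n → x k ≠ w) →
      word lab x i n ∈ Z₂)
    (hv : ∃ N, ∀ k ≥ N, x k ≠ v) : False := by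
  obtain ⟨N, hN⟩ := hv
  by_cases hw : ∃ M, ∀ k ≥ M, x k ≠ w
  -- If `w` also disappears, a repeated vertex bounds a closed factor that avoids both cut vertices.
  · obtain ⟨M, hM⟩ := hw
    obtain ⟨a, b, hab, hx⟩ := Finite.exists_ne_map_eq_of_infinite fun k => x (N + M + k)
    wlog hlt : a < b generalizing a b
    · exact this b a hab.symm hx.symm (by omega)
    obtain ⟨m, rfl⟩ := Nat.exists_eq_add_of_lt hlt
    have h : x (N + M + a + (m + 1)) = x (N + M + a) := by
      rw [hx]; congr 1; omega
    exact hd _ (hA _ _ m.succ_pos h fun k _ _ => hN k (by omega))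
      (hB _ _ m.succ_pos h fun k _ _ => hM k (by omega))
  -- Otherwise two late visits to `w` bound a closed factor that avoids `v`.
  · push Not at hw
    obtain ⟨k, hk, hxk⟩ := hw N
    obtain ⟨l, hl, hxl⟩ := hw (k + 1)
    obtain ⟨m, rfl⟩ := Nat.exists_eq_add_of_le hl
    have e : k + 1 + m = k + (m + 1) := by omega
    rw [e] at hxl
    exact hd _ (hA _ _ m.succ_pos (hxl.trans hxk.symm) fun t _ _ => hN t (by omega))
      (word_mem_of_endpoints hZ₂ hB _ _ m.succ_pos hxk hxl)

/-- Both vertices recur. Direct passages from `v` to `w` have bounded length, so two disjoint ones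
have the same word `p`. With `q` the word between them, `pq` is closed at `v` and `qp` is closed at
`w`. -/
theorem false_of_two_cut_vertices [Finite V] {Z₁ Z₂ : CycleProperty U}
    (hd : ∀ u, u ∈ Z₁ → u ∉ Z₂) (hcyc : ClosedUnderCyclicPerm Z₁)
    (hZ₁ : ClosedUnderConcat Z₁) (hZ₂ : ClosedUnderConcat Z₂) {x : ℕ → V} {v w : V} (hvw : v ≠ w)
    (hA : ∀ i n, 0 < n → x (i + n) = x i → (∀ k, i < k → k < i + n → x k ≠ v) →
      word lab x i n ∈ Z₁)
    (hB : ∀ i n, 0 < n → x (i + n) = x i → (∀ k, i < k → k < i + n → x k ≠ w) →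
      word lab x i n ∈ Z₂) : False := by
  classical
  have hv : ∀ N, ∃ k ≥ N, x k = v := by
    by_contra! h
    exact false_of_finitely_often hd hZ₂ hA hB h
  have hw : ∀ N, ∃ k ≥ N, x k = w := by
    by_contra! h
    exact false_of_finitely_often (fun u h₂ h₁ => hd u h₁ h₂) hZ₁ hB hA h
  have key : ∀ N, ∃ i, N ≤ i ∧ ∃ n : Fin (Nat.card V + 2),
      0 < n.1 ∧ x i = v ∧ x (i + n) = w := by
    intro N
    obtain ⟨i₀, hi₀, hxi₀⟩ := hv N
    have hex : ∃ j, i₀ ≤ j ∧ x j = w := hw i₀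
    -- The first visit to `w` from `i₀` on, and then the last visit to `v` before it, delimit a
    -- direct passage.
    set j := Nat.find hex with hj
    obtain ⟨hij, hxj⟩ : i₀ ≤ j ∧ x j = w := Nat.find_spec hex
    set i := Nat.findGreatest (fun k => x k = v) j with hi
    have hxi : x i = v := Nat.findGreatest_spec (P := fun k => x k = v) hij hxi₀
    have hii : i₀ ≤ i := Nat.le_findGreatest hij hxi₀
    have hle : i ≤ j := Nat.findGreatest_le j
    have hlt : i < j := lt_of_le_of_ne hle fun h => hvw (by rw [← hxi, h, hxj])
    have hnv : ∀ k, i < k → k < j → x k ≠ v := fun k h1 h2 =>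
      Nat.findGreatest_is_greatest (P := fun k => x k = v) h1 h2.le
    have hnw : ∀ k, i < k → k < j → x k ≠ w := fun k h1 h2 h3 =>
      Nat.find_min hex h2 ⟨by omega, h3⟩
    -- A vertex repeated strictly inside the passage would bound a closed factor avoiding both `v`
    -- and `w`, so there are at most `Nat.card V` interior positions.
    have hbound : j - i < Nat.card V + 2 := by
      by_contra! hlong
      have : ¬ Function.Injective fun t : Fin (Nat.card V + 1) => x (i + 1 + t) := fun hinj => by
        have := Nat.card_le_card_of_injective _ hinj
        simp at this
      simp only [Function.Injective, not_forall] at this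
      obtain ⟨a, b, hab, hne⟩ := this
      wlog hlt : a < b generalizing a b
      · exact this b a hab.symm (Ne.symm hne) (lt_of_le_of_ne (not_lt.1 hlt) (Ne.symm hne))
      have hlt' : a.1 < b.1 := hlt
      obtain ⟨m, hm⟩ := Nat.exists_eq_add_of_lt hlt'
      have hb := b.2
      have h : x (i + 1 + a + (m + 1)) = x (i + 1 + a) := by
        rw [hab, hm]; congr 1; omega
      exact hd _ (hA _ _ m.succ_pos h fun k _ _ => hnv k (by omega) (by omega))
        (hB _ _ m.succ_pos h fun k _ _ => hnw k (by omega) (by omega))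
    refine ⟨i, by omega, ⟨j - i, hbound⟩, by simpa using hlt, hxi, ?_⟩
    rw [← hxj]; congr 1; simp; omega
  choose i hNi n hn hxv hxw using key
  -- Windows of a fixed length make the target of the pigeonhole finite; `M` is then taken so large
  -- that its passage starts after the one of `N` has ended.
  obtain ⟨⟨n₀, g⟩, hy⟩ := Finite.exists_infinite_fiber
    fun N => (n N, fun t : Fin (Nat.card V + 2) => x (i N + t))
  have hinf := Set.infinite_coe_iff.1 hy
  obtain ⟨N, hN⟩ := hinf.nonempty
  obtain ⟨M, hM, hlt⟩ := hinf.exists_gt (i N + n N)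
  have hNM := hN.trans hM.symm
  simp only [Prod.mk.injEq] at hNM
  obtain ⟨hnn, hg⟩ := hNM
  have hp : word lab x (i N) (n N) = word lab x (i M) (n M) := by
    rw [hnn]
    exact word_congr fun k hk => congrFun hg ⟨k, by have := (n M).2; omega⟩
  obtain ⟨m, hm⟩ := Nat.exists_eq_add_of_le (hlt.le.trans (hNi M))
  have h1 := word_mem_of_endpoints hZ₁ hA (n N + m) (i N) (by have := hn N; omega) (hxv N)
    (by rw [← hxv M, hm, add_assoc])
  have h2 := word_mem_of_endpoints hZ₂ hB (m + n M) (i N + n N) (by have := hn M; omega) (hxw N)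
    (by rw [← hxw M, hm, add_assoc (i N + (n N : ℕ))])
  rw [word_add, hp] at h1
  rw [word_add, ← hm] at h2
  exact hd _ (hcyc.append_comm _ _ h1) h2

end Words

/-! ### Positional strategies on finite graphs -/

section Positional

variable {V U : Type*} {lab : V → V → U}

/-- All closed walks along `R` that are reachable from `a` have their word in `Z`. -/
def Good (lab : V → V → U) (R : V → V → Prop) (Z : CycleProperty U) (a : V) : Prop :=
  ∀ b, ReflTransGen R a b → ∀ (x : ℕ → V) (n : ℕ), 0 < n → (∀ k < n, R (x k) (x (k + 1))) →
    x 0 = b → x n = b → word lab x 0 n ∈ Z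

theorem Good.of_reachable {R : V → V → Prop} {Z : CycleProperty U} {a b : V}
    (h : Good lab R Z a) (hab : ReflTransGen R a b) : Good lab R Z b :=
  fun c hc => h c (hab.trans hc)

theorem Good.word_mem {R : V → V → Prop} {Z : CycleProperty U} {x : ℕ → V} {i n : ℕ}
    (h : Good lab R Z (x i)) (hn : 0 < n) (hR : ∀ k < n, R (x (i + k)) (x (i + k + 1)))
    (hx : x (i + n) = x i) : word lab x i n ∈ Z := by
  have := h (x i) .refl (fun k => x (i + k)) n hn hR rfl hx
  rwa [word_congr (j := i) (y := x) fun k _ => by rw [zero_add]] at this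

/-- Transfers strategies between graphs: only the moves inside a region that cannot be left matter.
-/
theorem Good.of_step_imp {R R' : V → V → Prop} {Z : CycleProperty U} {S : Set V} {a : V}
    (ha : a ∈ S) (hS : ∀ b ∈ S, ∀ c, R' b c → R b c ∧ c ∈ S) (h : Good lab R Z a) :
    Good lab R' Z a := by
  have hreach : ∀ b, ReflTransGen R' a b → ReflTransGen R a b ∧ b ∈ S := by
    intro b hb
    induction hb with
    | refl => exact ⟨.refl, ha⟩
    | tail _ hbc ih => exact ⟨ih.1.tail (hS _ ih.2 _ hbc).1, (hS _ ih.2 _ hbc).2⟩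
  intro b hb x n hn hx h0 hxn
  have hmem : ∀ k ≤ n, x k ∈ S := by
    intro k
    induction k with
    | zero => exact fun _ => h0 ▸ (hreach b hb).2
    | succ k ih => exact fun hk => (hS _ (ih (by omega)) _ (hx k hk)).2
  exact h b (hreach b hb).1 x n hn (fun k hk => (hS _ (hmem k hk.le) _ (hx k hk)).1) h0 hxn

/-- The moves that remain when player `i` plays the positional strategy `σ`. -/
def Step (owner : V → Fin 2) (F : V → V → Prop) (i : Fin 2) (σ : V → V) (a b : V) : Prop :=
  F a b ∧ (owner a = i → b = σ a)

/-- `W i` is won by player `i` with the positional strategy `σ i`, in the sense that all closed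
walks that can arise are in `C i`. -/
structure Solution (lab : V → V → U) (owner : V → Fin 2) (C : Fin 2 → CycleProperty U)
    (F : V → V → Prop) where
  W : Fin 2 → Set V
  σ : Fin 2 → V → V
  cover : ∀ a, ∃ i, a ∈ W i
  legal : ∀ i a, F a (σ i a)
  good : ∀ i, ∀ a ∈ W i, Good lab (Step owner F i (σ i)) (C i) a

variable {owner : V → Fin 2} {C : Fin 2 → CycleProperty U} {F : V → V → Prop}

/-- Playing `σ` against `τ` follows one function on a finite set, which runs into a closed walk that
is consistent with both strategies. -/
theorem Good.false_of_opponent [Finite V] {i j : Fin 2} (hij : i ≠ j)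
    (hd : ∀ u, u ∈ C i → u ∉ C j) {σ τ : V → V} (hσ : ∀ a, F a (σ a)) (hτ : ∀ a, F a (τ a)) {a : V}
    (h₁ : Good lab (Step owner F i σ) (C i) a) (h₂ : Good lab (Step owner F j τ) (C j) a) :
    False := by
  classical
  let f : V → V := fun b => if owner b = i then σ b else τ b
  let x : ℕ → V := fun n => f^[n] a
  have hx : ∀ k, x (k + 1) = f (x k) := fun k => Function.iterate_succ_apply' f k a
  have hf₁ : ∀ b, Step owner F i σ b (f b) := by
    intro b
    by_cases hb : owner b = i
    · simpa [f, hb, Step] using hσ b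
    · simpa [f, hb, Step] using hτ b
  have hf₂ : ∀ b, Step owner F j τ b (f b) := by
    intro b
    by_cases hb : owner b = i
    · simpa [f, hb, Step, hij] using hσ b
    · simpa [f, hb, Step] using hτ b
  have hr₁ : ∀ k, ReflTransGen (Step owner F i σ) a (x k) := by
    intro k
    induction k with
    | zero => exact .refl
    | succ k ih => exact ih.tail (hx k ▸ hf₁ _)
  have hr₂ : ∀ k, ReflTransGen (Step owner F j τ) a (x k) := by
    intro k
    induction k with
    | zero => exact .refl
    | succ k ih => exact ih.tail (hx k ▸ hf₂ _)
  obtain ⟨m, n, hmn, he⟩ := Finite.exists_ne_map_eq_of_infinite x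
  wlog hlt : m < n generalizing m n
  · exact this n m hmn.symm he.symm (by omega)
  obtain ⟨l, rfl⟩ := Nat.exists_eq_add_of_lt hlt
  exact hd _ ((h₁.of_reachable (hr₁ m)).word_mem l.succ_pos (fun k _ => hx (m + k) ▸ hf₁ _) he.symm)
    ((h₂.of_reachable (hr₂ m)).word_mem l.succ_pos (fun k _ => hx (m + k) ▸ hf₂ _) he.symm)

namespace Solution

theorem mem_of_notMem (S : Solution lab owner C F) {i j : Fin 2} (hij : i ≠ j) {a : V}
    (h : a ∉ S.W i) : a ∈ S.W j := by
  obtain ⟨k, hk⟩ := S.cover a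
  have : k ≠ i := fun e => h (e ▸ hk)
  rwa [show j = k by omega]

theorem notMem_of_mem [Finite V] (S : Solution lab owner C F) {i j : Fin 2} (hij : i ≠ j)
    (hd : ∀ u, u ∈ C i → u ∉ C j) {a : V}
    (h : a ∈ S.W i) : a ∉ S.W j := fun h' =>
  Good.false_of_opponent hij hd (S.legal i) (S.legal j) (S.good i a h) (S.good j a h')

/-- If the step left the region, the opponent would win at its end, where `σ i` is still good. -/
theorem mem_of_step [Finite V] (S : Solution lab owner C F) {i j : Fin 2} (hij : i ≠ j)
    (hd : ∀ u, u ∈ C i → u ∉ C j) {a b : V}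
    (h : a ∈ S.W i) (hab : Step owner F i (S.σ i) a b) : b ∈ S.W i := by
  by_contra hb
  exact Good.false_of_opponent hij hd (S.legal i) (S.legal j)
    ((S.good i a h).of_reachable (.single hab)) (S.good j b (S.mem_of_notMem hij hb))

end Solution

/-! ### Splitting the edges of a player at one vertex -/

/-- The edges left when, at `v`, only the successor `c` is kept, or only the others are. -/
def restrict (F : V → V → Prop) (v c : V) (b : Bool) (x y : V) : Prop :=
  F x y ∧ (x = v → (y = c ↔ b = true))

/-- The outcome of splitting the edges of player `i` at `v` when `v` is won by the opponent `j` in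
both parts: a region `W` won by player `i` in the whole graph, such that `j` wins the rest in both
parts. -/
structure SplitSolution (lab : V → V → U) (owner : V → Fin 2) (C : Fin 2 → CycleProperty U)
    (F : V → V → Prop) (i j : Fin 2) where
  v : V
  c : V
  owner_v : owner v = i
  W : Set V
  σ : V → V
  τ : Bool → V → V
  v_notMem : v ∉ W
  legal_σ : ∀ a, F a (σ a)
  legal_τ : ∀ b a, restrict F v c b a (τ b a)
  good_σ : ∀ a ∈ W, Good lab (Step owner F i σ) (C i) a
  good_τ : ∀ b, ∀ a ∉ W, Good lab (Step owner (restrict F v c b) j (τ b)) (C j) a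
  closed : ∀ b, ∀ a ∉ W, ∀ a', Step owner (restrict F v c b) j (τ b) a a' → a' ∉ W

/-- Two players' data on complementary regions form a solution. -/
theorem nonempty_solution_of_pair {i j : Fin 2} (hij : i ≠ j) {Wi Wj : Set V} {σ τ : V → V}
    (hcov : ∀ a, a ∉ Wi → a ∈ Wj) (hσ : ∀ a, F a (σ a)) (hτ : ∀ a, F a (τ a))
    (hi : ∀ a ∈ Wi, Good lab (Step owner F i σ) (C i) a)
    (hj : ∀ a ∈ Wj, Good lab (Step owner F j τ) (C j) a) :
    Nonempty (Solution lab owner C F) := by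
  classical
  have hk : ∀ k, k ≠ i → k = j := fun k hk => by omega
  refine ⟨⟨fun k => if k = i then Wi else Wj, fun k => if k = i then σ else τ, fun a => ?_,
    fun k a => ?_, fun k a ha => ?_⟩⟩
  · by_cases h : a ∈ Wi
    · exact ⟨i, by simpa using h⟩
    · exact ⟨j, by simpa [hij.symm] using hcov a h⟩
  · split_ifs
    exacts [hσ a, hτ a]
  · by_cases h : k = i
    · subst h
      simp only [if_true] at ha ⊢
      exact hi a ha
    · obtain rfl := hk k h
      simp only [h, if_false] at ha ⊢
      exact hj a ha

theorem solution_or_splitSolution [Finite V] {i j : Fin 2} (hij : i ≠ j)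
    (hd : ∀ u, u ∈ C i → u ∉ C j) {v c : V} (hv : owner v = i)
    (S : ∀ b, Solution lab owner C (restrict F v c b)) :
    Nonempty (Solution lab owner C F) ∨ Nonempty (SplitSolution lab owner C F i j) := by
  classical
  have hd' : ∀ u, u ∈ C j → u ∉ C i := fun u h₁ h₂ => hd u h₂ h₁
  by_cases h : ∃ b, v ∈ (S b).W i
  · obtain ⟨b, hb⟩ := h
    refine .inl (nonempty_solution_of_pair hij (Wi := (S b).W i) (Wj := (S b).W j)
      (σ := (S b).σ i) (τ := (S b).σ j) (fun a => (S b).mem_of_notMem hij)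
      (fun a => ((S b).legal i a).1) (fun a => ((S b).legal j a).1) (fun a ha => ?_)
      (fun a ha => ?_))
    -- The strategy of `i` uses an edge of part `b` at `v`, so the missing edges never occur.
    · refine Good.of_step_imp (S := Set.univ) trivial (fun x _ y hxy => ⟨?_, trivial⟩)
        ((S b).good i a ha)
      refine ⟨⟨hxy.1, ?_⟩, hxy.2⟩
      rintro rfl
      rw [hxy.2 hv]
      exact ((S b).legal i x).2 rfl
    -- The region of `j` excludes `v` and cannot be left, so the missing edges are out of reach.
    · refine Good.of_step_imp ha (fun x hx y hxy => ?_) ((S b).good j a ha)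
      have hstep : Step owner (restrict F v c b) j ((S b).σ j) x y := by
        refine ⟨⟨hxy.1, ?_⟩, hxy.2⟩
        rintro rfl
        exact ((S b).notMem_of_mem hij hd hb hx).elim
      exact ⟨hstep, (S b).mem_of_step hij.symm hd' hx hstep⟩
  · push Not at h
    have hoff : ∀ b, ∀ x ∈ (S b).W i, x ≠ v := fun b x hx e => h b (e ▸ hx)
    have transfer : ∀ (b : Bool) (G : V → V → Prop) (ρ : V → V), (∀ x y, G x y → F x y) →
        (∀ x, x ≠ v → ρ x = (S b).σ i x) → ∀ a ∈ (S b).W i,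
        Good lab (Step owner G i ρ) (C i) a := by
      intro b G ρ hG hρ a ha
      refine Good.of_step_imp ha (fun x hx y hxy => ?_) ((S b).good i a ha)
      have hxv := hoff b x hx
      have hstep : Step owner (restrict F v c b) i ((S b).σ i) x y :=
        ⟨⟨hG _ _ hxy.1, fun e => (hxv e).elim⟩, fun ho => by rw [hxy.2 ho, hρ x hxv]⟩
      exact ⟨hstep, (S b).mem_of_step hij hd hx hstep⟩
    -- The region of `i` avoids `v`, so its strategy also works in the other part; the patch at `v`
    -- only makes it legal there.
    have hsub : ∀ b b', (S b).W i ⊆ (S b').W i := by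
      intro b b' a ha
      by_contra ha'
      refine Good.false_of_opponent (F := restrict F v c b') hij hd
        (σ := fun x => if x = v then (S b').σ i x else (S b).σ i x) (fun x => ?_)
        ((S b').legal j) (transfer b _ _ (fun _ _ hxy => hxy.1) (fun x hx => if_neg hx) a ha)
        ((S b').good j a ((S b').mem_of_notMem hij ha'))
      by_cases hx : x = v
      · simpa [hx] using (S b').legal i v
      · simpa [hx, restrict] using ((S b).legal i x).1
    have hW : ∀ b a, a ∉ (S true).W i → a ∈ (S b).W j := fun b a ha =>
      (S b).mem_of_notMem hij fun hb => ha (hsub _ _ hb)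
    exact .inr ⟨⟨v, c, hv, (S true).W i, (S true).σ i, fun b => (S b).σ j, h true,
      fun a => ((S true).legal i a).1, fun b a => (S b).legal j a,
      transfer true F _ (fun _ _ h => h) (fun _ _ => rfl),
      fun b a ha => (S b).good j a (hW b a ha), fun b a ha a' haa' ha' =>
        (S b).notMem_of_mem hij hd (hsub true b ha')
          ((S b).mem_of_step hij.symm hd' (hW b a ha) haa')⟩⟩

/-- The step from `x k` uses the bit `b (k + 1)`, updated by that very step. A factor without
interior visits to `v` thus uses one bit throughout, even if it starts at `v`. -/
theorem word_mem_of_bits {Z : CycleProperty U} {G : Bool → V → V → Prop} {x : ℕ → V} {b : ℕ → Bool}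
    {v : V} (hG : ∀ k, G (b (k + 1)) (x k) (x (k + 1))) (hb : ∀ k, x k ≠ v → b (k + 1) = b k)
    (hgood : ∀ k d, Good lab (G d) Z (x k)) (i n : ℕ) (hn : 0 < n) (hx : x (i + n) = x i)
    (hv : ∀ k, i < k → k < i + n → x k ≠ v) : word lab x i n ∈ Z := by
  have hconst : ∀ k < n, b (i + k + 1) = b (i + 1) := by
    intro k
    induction k with
    | zero => simp
    | succ k ih =>
      intro hk
      rw [← ih (by omega)]
      exact hb _ (hv _ (by omega) (by omega))
  exact (hgood i (b (i + 1))).word_mem hn (fun k hk => hconst k hk ▸ hG (i + k)) hx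

/-- If the opponent has no choices, a split solution yields a solution. -/
theorem SplitSolution.nonempty_solution_of_forced {i j : Fin 2} (hij : i ≠ j)
    (hd : ∀ u, u ∈ C i → u ∉ C j) (hcover : ∀ u, u ∉ C j → u ∈ C i)
    (hcyc : ClosedUnderCyclicPerm (C i)) (hconcat : ClosedUnderConcat (C j))
    (S : SplitSolution lab owner C F i j)
    (hforced : ∀ a, owner a = j → ∀ b c, F a b → F a c → b = c) :
    Nonempty (Solution lab owner C F) := by
  classical
  obtain ⟨v, c, hv, W, σ, τ, hvW, hσ, hτ, hgσ, hgτ, hcl⟩ := S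
  refine nonempty_solution_of_pair hij (Wi := W) (Wj := Wᶜ) (fun a ha => ha) hσ
    (fun a => (hτ true a).1) hgσ fun a ha => ?_
  -- Since `j` has no choices, every edge agrees with `τ b` as soon as `b` is the part containing
  -- it.
  have hstep : ∀ (b : Bool) (x y : V), F x y → (x = v → b = decide (y = c)) →
      Step owner (restrict F v c b) j (τ b) x y := fun b x y hxy hb =>
    ⟨⟨hxy, fun e => by simp [hb e]⟩, fun ho => hforced x ho _ _ hxy (hτ b x).1⟩
  have hclF : ∀ x ∉ W, ∀ y, F x y → y ∉ W := fun x hx y hxy =>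
    hcl (decide (y = c)) x hx y (hstep _ x y hxy fun _ => rfl)
  intro a' haa' x n hn hx h0 hxn
  have ha' : a' ∉ W := by
    clear h0 hxn
    induction haa' with
    | refl => exact ha
    | tail _ h ih => exact hclF _ ih _ h.1
  -- Repeating the closed walk forever makes it possible to restart it at a visit to `v`.
  let y : ℕ → V := fun t => x (t % n)
  have hper : ∀ k ≥ 0, y (k + n) = y k := fun k _ => by simp [y]
  have hyF : ∀ k, F (y k) (y (k + 1)) := by
    intro k
    have hk := Nat.mod_lt k hn
    rcases Nat.lt_or_ge (k % n + 1) n with h | h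
    · have e : (k + 1) % n = k % n + 1 := by
        rw [Nat.add_mod, Nat.mod_eq_of_lt (show 1 < n by omega), Nat.mod_eq_of_lt h]
      simpa [y, e] using (hx _ hk).1
    · have e' : k % n + 1 = n := by omega
      have e : (k + 1) % n = 0 := by
        rw [← Nat.mod_add_mod, e', Nat.mod_self]
      have := (hx _ hk).1
      rw [e', hxn, ← h0] at this
      simpa [y, e] using this
  have hyW : ∀ k, y k ∉ W := by
    intro k
    induction k with
    | zero => simpa [y, h0] using ha'
    | succ k ih => exact hclF _ ih _ (hyF k)
  let b : ℕ → Bool := fun k =>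
    Nat.rec true (fun k b => if y k = v then decide (y (k + 1) = c) else b) k
  have hb : ∀ k, b (k + 1) = if y k = v then decide (y (k + 1) = c) else b k := fun k => rfl
  have hA := word_mem_of_bits (lab := lab) (Z := C j) (x := y) (b := b) (v := v)
    (G := fun b => Step owner (restrict F v c b) j (τ b))
    (fun k => hstep _ _ _ (hyF k) fun e => by simp [hb, e]) (fun k hk => by simp [hb, hk])
    (fun k d => hgτ d _ (hyW k))
  have hword : word lab y 0 n ∈ C j := by
    by_cases hvy : ∃ k, y k = v
    · obtain ⟨k, hk⟩ := hvy
      have h1 := word_mem_of_endpoints hconcat hA n k hn hk ((hper k (Nat.zero_le k)).trans hk)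
      by_contra h2
      exact hd _ (word_rotate hcyc hper (hcover _ h2) k (Nat.zero_le k)) h1
    · push Not at hvy
      exact hA 0 n hn (hper 0 le_rfl) fun k _ _ => hvy k
  rwa [word_congr (x := y) (y := x) (j := 0)] at hword
  intro k hk
  rcases hk.lt_or_eq with h | rfl
  · simp [y, Nat.mod_eq_of_lt h]
  · simp [y, h0, hxn]

/-- Playing the memory strategies of both players against each other. -/
theorem SplitSolution.mem_or_mem [Finite V] {i j : Fin 2} (hij : i ≠ j)
    (hd : ∀ u, u ∈ C j → u ∉ C i) (hcyc : ClosedUnderCyclicPerm (C j))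
    (hconcat : ∀ k, ClosedUnderConcat (C k))
    (S : SplitSolution lab owner C F i j) (T : SplitSolution lab owner C F j i) (a : V)
    (haS : a ∉ S.W) : a ∈ T.W := by
  classical
  -- The state is a vertex with one bit for each cut vertex, recording the part last used there.
  by_contra haT
  let next : V × Bool × Bool → V := fun s => if owner s.1 = i then T.τ s.2.2 s.1 else S.τ s.2.1 s.1
  let f : V × Bool × Bool → V × Bool × Bool := fun s =>
    (next s, if s.1 = S.v then decide (next s = S.c) else s.2.1,
      if s.1 = T.v then decide (next s = T.c) else s.2.2)
  let x : ℕ → V × Bool × Bool := fun n => f^[n] (a, true, true)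
  have hx : ∀ k, x (k + 1) = f (x k) := fun k => Function.iterate_succ_apply' f k _
  have hF : ∀ s, F s.1 (next s) := by
    intro s
    by_cases h : owner s.1 = i
    · simpa [next, h] using (T.legal_τ s.2.2 s.1).1
    · simpa [next, h] using (S.legal_τ s.2.1 s.1).1
  -- The updated bit may replace the old one in the strategy of `j`: they differ only at `S.v`,
  -- where `i` moves.
  have hS : ∀ s, Step owner (restrict F S.v S.c (f s).2.1) j (S.τ (f s).2.1) s.1 (f s).1 := by
    refine fun s => ⟨⟨hF s, fun e => by simp [f, e]⟩, fun ho => ?_⟩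
    have h1 : owner s.1 ≠ i := fun e => hij (e.symm.trans ho)
    have h2 : s.1 ≠ S.v := fun e => h1 (e ▸ S.owner_v)
    simp [f, h2, next, h1]
  have hT : ∀ s, Step owner (restrict F T.v T.c (f s).2.2) i (T.τ (f s).2.2) s.1 (f s).1 := by
    refine fun s => ⟨⟨hF s, fun e => by simp [f, e]⟩, fun ho => ?_⟩
    have h2 : s.1 ≠ T.v := fun e => hij (ho.symm.trans (e ▸ T.owner_v))
    simp [f, h2, next, ho]
  have hxS : ∀ k, (x k).1 ∉ S.W := by
    intro k
    induction k with
    | zero => exact haS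
    | succ k ih => exact S.closed _ _ ih _ (hx k ▸ hS (x k))
  have hxT : ∀ k, (x k).1 ∉ T.W := by
    intro k
    induction k with
    | zero => exact haT
    | succ k ih => exact T.closed _ _ ih _ (hx k ▸ hT (x k))
  refine false_of_two_cut_vertices (lab := lab) (x := fun k => (x k).1) hd hcyc
    (hconcat j) (hconcat i) (v := S.v) (w := T.v)
    (fun e => hij (S.owner_v.symm.trans (e ▸ T.owner_v)))
    (word_mem_of_bits (b := fun k => (x k).2.1)
      (G := fun b => Step owner (restrict F S.v S.c b) j (S.τ b))
      (fun k => hx k ▸ hS (x k)) (fun k hk => ?_) fun k d => S.good_τ d _ (hxS k))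
    (word_mem_of_bits (b := fun k => (x k).2.2)
      (G := fun b => Step owner (restrict F T.v T.c b) i (T.τ b))
      (fun k => hx k ▸ hT (x k)) (fun k hk => ?_) fun k d => T.good_τ d _ (hxT k))
  · simp only [hx, f, if_neg hk]
  · simp only [hx, f, if_neg hk]

/-! ### Graphs without choices, and the induction on edges -/

/-- In a graph of a function, a vertex that is not good has a bad period. -/
theorem exists_period_of_not_good {R : V → V → Prop} {Z : CycleProperty U} {f : V → V}
    (hf : ∀ a b, R a b → b = f a) {a : V} (h : ¬ Good lab R Z a) :
    ∃ i n, 0 < n ∧ (∀ k ≥ i, f^[k + n] a = f^[k] a) ∧ word lab (fun k => f^[k] a) i n ∉ Z := by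
  simp only [Good, not_forall] at h
  obtain ⟨b, hab, x, n, hn, hR, h0, hxn, hw⟩ := h
  have hi : ∃ i, f^[i] a = b := by
    clear h0 hxn
    induction hab with
    | refl => exact ⟨0, rfl⟩
    | tail _ hbc ih =>
      obtain ⟨i, rfl⟩ := ih
      exact ⟨i + 1, by rw [Function.iterate_succ_apply', hf _ _ hbc]⟩
  obtain ⟨i, hi⟩ := hi
  have hx : ∀ k ≤ n, x k = f^[i + k] a := by
    intro k
    induction k with
    | zero => exact fun _ => h0.trans hi.symm
    | succ k ih =>
      intro hk
      rw [hf _ _ (hR k hk), ih (by omega), ← add_assoc, Function.iterate_succ_apply']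
  refine ⟨i, n, hn, fun k hk => ?_, ?_⟩
  · have h1 : f^[i + n] a = f^[i] a := by rw [← hx n le_rfl, hxn, hi]
    obtain ⟨m, rfl⟩ := Nat.exists_eq_add_of_le hk
    rw [show i + m + n = m + (i + n) by omega, Function.iterate_add_apply, h1,
      ← Function.iterate_add_apply, add_comm m i]
  · rwa [word_congr (y := x) (j := 0) fun k hk => by simp [hx k hk]]

/-- Only one path leaves each vertex. Were it bad for both players, it would have a period of each
kind; repeating both up to a common length from a common position gives a single word of both kinds.
-/
theorem nonempty_solution_of_functional (hd : ∀ u, u ∈ C 0 → u ∉ C 1)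
    (hcover : ∀ u, u ∉ C 0 → u ∈ C 1) (hcyc : ∀ i, ClosedUnderCyclicPerm (C i))
    (hconcat : ∀ i, ClosedUnderConcat (C i)) (hserial : ∀ a, ∃ b, F a b)
    (hfun : ∀ a b c, F a b → F a c → b = c) : Nonempty (Solution lab owner C F) := by
  choose f hf using hserial
  refine ⟨⟨fun i => {a | Good lab (Step owner F i f) (C i) a}, fun _ => f, fun a => ?_,
    fun _ => hf, fun i a ha => ha⟩⟩
  by_contra! h
  have hstep : ∀ i a b, Step owner F i f a b → b = f a := fun i a b hab => hfun _ _ _ hab.1 (hf a)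
  obtain ⟨i, m, hm, hpm, hwm⟩ := exists_period_of_not_good (hstep 0) (h 0)
  obtain ⟨j, n, hn, hpn, hwn⟩ := exists_period_of_not_good (hstep 1) (h 1)
  have h1 := word_mul_mem (hcyc 1) (hconcat 1) hpm (hcover _ hwm) (n - 1) (i + j) (by omega)
  have h2 := word_mul_mem (hcyc 0) (hconcat 0) hpn (not_not.1 fun hc => hwn (hcover _ hc))
    (m - 1) (i + j) (by omega)
  rw [Nat.sub_add_cancel hn] at h1
  rw [Nat.sub_add_cancel hm, mul_comm] at h2
  exact hd _ h2 h1

theorem nonempty_solution [Finite V] (hd : ∀ i j, i ≠ j → ∀ u, u ∈ C i → u ∉ C j)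
    (hcover : ∀ i j, i ≠ j → ∀ u, u ∉ C i → u ∈ C j) (hcyc : ∀ i, ClosedUnderCyclicPerm (C i))
    (hconcat : ∀ i, ClosedUnderConcat (C i)) (hserial : ∀ a, ∃ b, F a b) :
    Nonempty (Solution lab owner C F) := by
  classical
  induction hN : {p : V × V | F p.1 p.2}.ncard using Nat.strong_induction_on generalizing F with
  | _ N ih =>
  subst hN
  have split : ∀ i j, i ≠ j → (¬ ∀ a, owner a = i → ∀ b c, F a b → F a c → b = c) →
      Nonempty (Solution lab owner C F) ∨ Nonempty (SplitSolution lab owner C F i j) := by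
    intro i j hij h
    push Not at h
    obtain ⟨v, hv, c, c', hc, hc', hne⟩ := h
    have hS : ∀ b, Nonempty (Solution lab owner C (restrict F v c b)) := by
      intro b
      -- Part `true` loses the edge to `c'`, part `false` the edge to `c`.
      refine ih _ (Set.ncard_lt_ncard ⟨fun p hp => hp.1, fun hsub => ?_⟩) (fun a => ?_) rfl
      · cases b with
        | true => exact hne ((hsub (a := (v, c')) hc').2 rfl |>.2 rfl).symm
        | false => exact absurd ((hsub (a := (v, c)) hc).2 rfl |>.1 rfl) (by simp)
      · by_cases ha : a = v
        · subst ha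
          cases b with
          | true => exact ⟨c, hc, by simp⟩
          | false => exact ⟨c', hc', by simp [hne.symm]⟩
        · obtain ⟨b', hb'⟩ := hserial a
          exact ⟨b', hb', fun e => (ha e).elim⟩
    exact solution_or_splitSolution hij (hd i j hij) hv fun b => (hS b).some
  have forced : ∀ i j, i ≠ j → (∀ a, owner a = j → ∀ b c, F a b → F a c → b = c) →
      Nonempty (SplitSolution lab owner C F i j) → Nonempty (Solution lab owner C F) :=
    fun i j hij hf ⟨S⟩ => S.nonempty_solution_of_forced hij (hd i j hij) (hcover j i hij.symm)
      (hcyc i) (hconcat j) hf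
  by_cases h0 : ∀ a, owner a = 0 → ∀ b c, F a b → F a c → b = c <;>
  by_cases h1 : ∀ a, owner a = 1 → ∀ b c, F a b → F a c → b = c
  · refine nonempty_solution_of_functional (hd 0 1 (by simp)) (hcover 0 1 (by simp)) hcyc hconcat
      hserial fun a b c => ?_
    have : owner a = 0 ∨ owner a = 1 := by omega
    exact this.elim (fun h => h0 a h b c) fun h => h1 a h b c
  · exact (split 1 0 (by simp) h1).elim id (forced 1 0 (by simp) h0)
  · exact (split 0 1 (by simp) h0).elim id (forced 0 1 (by simp) h1)
  · obtain h | ⟨⟨S⟩⟩ := split 0 1 (by simp) h0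
    · exact h
    obtain h | ⟨⟨T⟩⟩ := split 1 0 (by simp) h1
    · exact h
    exact nonempty_solution_of_pair (i := 0) (j := 1) (by simp)
      (SplitSolution.mem_or_mem (by simp) (hd 1 0 (by simp)) (hcyc 1) hconcat S T)
      S.legal_σ T.legal_σ S.good_σ T.good_σ

end Positional

/-! ### From positional solutions to games on arenas -/

namespace Arena

variable {V U : Type*} {A : Arena V U}

/-! ### Cycles output by the decomposition -/

theorem step_subset {P : A.E → Prop} {s : List A.E} {e : A.E} (hs : ∀ f ∈ s, P f) (he : P e) :
    (∀ f ∈ (step s e).1, P f) ∧ ∀ u, (step s e).2 = some u → IsCycle u ∧ ∀ f ∈ u, P f := by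
  classical
  have hes : ∀ f ∈ e :: s, P f := List.forall_mem_cons.2 ⟨he, hs⟩
  unfold step
  split_ifs with h
  · refine ⟨fun f hf => hes f (List.mem_of_mem_drop hf), ?_⟩
    rintro u ⟨⟩
    exact ⟨Nat.find_spec h, fun f hf => hes f (List.mem_of_mem_take (List.mem_reverse.1 hf))⟩
  · exact ⟨hes, by simp⟩

/-- An output cycle need not be a factor of the play. All that is needed is that its edges come from
the play. -/
theorem Play.cycles_subset {P : A.E → Prop} {π : A.Play} (hπ : ∀ j, P (π.edge j)) :
    ∀ u ∈ π.cycles, IsCycle u ∧ ∀ f ∈ u, P f := by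
  have hstack : ∀ j, ∀ f ∈ π.stack j, P f := by
    intro j
    induction j with
    | zero => simp [Play.stack]
    | succ j ih => exact (step_subset ih (hπ j)).1
  rintro u ⟨j, hj⟩
  exact (step_subset (hstack j) (hπ j)).2 u hj

/-- Without output nothing is ever popped, so the stack is the whole history, and a repeated vertex
puts a cycle on top. -/
theorem Play.cycles_nonempty [Finite V] (π : A.Play) : π.cycles.Nonempty := by
  classical
  by_contra hempty
  have hno : ∀ j, ¬ ∃ k, IsCycle ((π.edge j :: π.stack j).take k).reverse := by
    intro j h
    refine hempty ⟨((π.edge j :: π.stack j).take (Nat.find h)).reverse, j, ?_⟩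
    simp [Play.output, step, h]
  have hstack : ∀ j, π.stack j = ((List.range j).map π.edge).reverse := by
    intro j
    induction j with
    | zero => rfl
    | succ j ih =>
      rw [Play.stack, step, dif_neg (hno j), ih, List.range_succ]
      simp
  obtain ⟨a, b, hab, hx⟩ := Finite.exists_ne_map_eq_of_infinite π.1
  wlog hlt : a < b generalizing a b
  · exact this b a hab.symm hx.symm (by omega)
  obtain ⟨m, rfl⟩ := Nat.exists_eq_add_of_lt hlt
  refine hno (a + m) ⟨m + 1, ?_⟩
  have hcons : π.edge (a + m) :: π.stack (a + m) =
      ((List.range (a + (m + 1))).map π.edge).reverse := by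
    rw [hstack, ← add_assoc, List.range_succ]
    simp
  have htake : ((π.edge (a + m) :: π.stack (a + m)).take (m + 1)).reverse =
      (List.range (m + 1)).map fun k => π.edge (a + k) := by
    rw [hcons, List.range_add, List.map_append, List.reverse_append, List.take_left' (by simp)]
    simp [Function.comp_def]
  rw [htake]
  refine ⟨by simp, ?_, ?_⟩
  · rw [List.isChain_iff_getElem]
    intro i hi
    simp [Play.edge, add_assoc]
  · simp only [List.getLast_map, List.head_map, List.getLast_range, List.head_range, Play.edge]
    simpa [add_assoc] using hx.symm

theorem IsCycle.exists_walk [Nonempty U] {u : List A.E} (hu : IsCycle u) :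
    ∃ x : ℕ → V, (∀ k (hk : k < u.length), (x k, x (k + 1)) = u[k].1) ∧ x u.length = x 0 := by
  obtain ⟨hne, hchain, hclose⟩ := hu
  have hpos := List.length_pos_iff.2 hne
  rw [List.isChain_iff_getElem] at hchain
  -- The default value past the end is the initial vertex, which closes the walk.
  refine ⟨fun t => if h : t < u.length then u[t].1.1 else u[0].1.1, fun k hk => ?_, by simp⟩
  by_cases h : k + 1 < u.length
  · simp only [hk, h, dif_pos]
    rw [← hchain k h]
  · have e : k = u.length - 1 := by omega
    rw [List.getLast_eq_getElem, List.head_eq_getElem] at hclose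
    subst e
    simp only [hk, dif_pos, dif_neg h]
    rw [← hclose]

open Classical in
/-- The labeling of an arena, extended to all pairs of vertices. -/
noncomputable def pairLabel [Nonempty U] (A : Arena V U) (x y : V) : U :=
  if h : (x, y) ∈ A.E then A.label ⟨(x, y), h⟩ else Classical.arbitrary U

theorem map_label_mem_of_good [Nonempty U] {R : V → V → Prop} {Z : CycleProperty U} {π : A.Play}
    (hπ : ∀ k, R (π.vertex k) (π.vertex (k + 1)))
    (hgood : Good A.pairLabel R Z (π.vertex 0)) :
    ∀ u ∈ π.cycles, u.map A.label ∈ Z := by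
  intro u hu
  have hreach : ∀ k, ReflTransGen R (π.vertex 0) (π.vertex k) := by
    intro k
    induction k with
    | zero => exact .refl
    | succ k ih => exact ih.tail (hπ k)
  obtain ⟨hcyc, hmem⟩ := Play.cycles_subset
    (P := fun e => ReflTransGen R (π.vertex 0) e.1.1 ∧ R e.1.1 e.1.2)
    (fun j => ⟨hreach j, hπ j⟩) u hu
  obtain ⟨x, hx, hclose⟩ := hcyc.exists_walk
  have hpos := List.length_pos_iff.2 hcyc.1
  have hxm : ∀ k < u.length, ReflTransGen R (π.vertex 0) (x k) ∧ R (x k) (x (k + 1)) := by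
    intro k hk
    have h := hmem _ (List.getElem_mem hk)
    rwa [← hx k hk] at h
  have hw := hgood (x 0) (hxm 0 hpos).1 x u.length hpos (fun k hk => (hxm k hk).2) rfl hclose
  convert hw using 1
  refine List.ext_getElem (by simp [word]) fun k hk _ => ?_
  have hk : k < u.length := by simpa using hk
  have he : (x k, x (k + 1)) ∈ A.E := by rw [hx k hk]; exact u[k].2
  have : u[k] = ⟨(x k, x (k + 1)), he⟩ := Subtype.ext (hx k hk).symm
  simp [word, pairLabel, he, this]

/-! ### Determinacy of games on arenas -/

theorem exists_play_consistent_both (S : A.Strategy 0) (T : A.Strategy 1) (v : V) :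
    ∃ π : A.Play, π.vertex 0 = v ∧ π.Consistent S ∧ π.Consistent T := by
  classical
  have howner : ∀ w, A.owner w ≠ 0 → A.owner w = 1 := fun w h => by omega
  let next : List V × V → V := fun s =>
    if h : A.owner s.2 = 0 then S.move s.1 ⟨s.2, h⟩ else T.move s.1 ⟨s.2, howner _ h⟩
  -- The history is part of the state because the strategies may depend on it.
  let x : ℕ → List V × V := fun n => (fun s => (s.1 ++ [s.2], next s))^[n] ([], v)
  have hx : ∀ k, x (k + 1) = ((x k).1 ++ [(x k).2], next (x k)) :=
    fun k => Function.iterate_succ_apply' _ k _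
  have hE : ∀ s, (s.2, next s) ∈ A.E := by
    intro s
    by_cases h : A.owner s.2 = 0
    · simpa [next, h] using S.legal s.1 ⟨s.2, h⟩
    · simpa [next, h] using T.legal s.1 ⟨s.2, howner _ h⟩
  have hhist : ∀ k, (x k).1 = (List.range k).map fun j => (x j).2 := by
    intro k
    induction k with
    | zero => rfl
    | succ k ih => rw [hx, List.range_succ, ih]; simp
  refine ⟨⟨fun k => (x k).2, fun k => show ((x k).2, (x (k + 1)).2) ∈ A.E from hx k ▸ hE _⟩, rfl,
    fun k h => ?_, fun k h => ?_⟩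
  · change A.owner (x k).2 = 0 at h
    change (x (k + 1)).2 = S.move ((List.range k).map fun j => (x j).2) ⟨(x k).2, h⟩
    rw [← hhist, hx]
    simp [next, h]
  · change A.owner (x k).2 = 1 at h
    change (x (k + 1)).2 = T.move ((List.range k).map fun j => (x j).2) ⟨(x k).2, h⟩
    rw [← hhist, hx]
    simp [next, h]

theorem disjoint_winningRegion (O : Set A.Play) :
    Disjoint (winningRegion O 0) (winningRegion O 1) := by
  rw [Set.disjoint_left]
  rintro v ⟨S, hS⟩ ⟨T, hT⟩
  obtain ⟨π, h0, hπS, hπT⟩ := exists_play_consistent_both S T v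
  have h1 := hS π h0 hπS
  have h2 := hT π h0 hπT
  simp only [WonBy, if_true] at h1
  simp only [WonBy, one_ne_zero, if_false] at h2
  exact h2 h1

/-- Two memoryless strategies winning from regions that cover the arena give uniform memoryless
determinacy. -/
theorem uniformMemorylessDetermined_of_cover {O : Set A.Play} {W : Fin 2 → Set V}
    (hcover : ∀ a, ∃ i, a ∈ W i)
    (hwin : ∀ i, ∃ S : A.Strategy i, S.Memoryless ∧ ∀ a ∈ W i, S.WinningFrom O a) :
    UniformMemorylessDetermined O := by
  have hsub : ∀ i, W i ⊆ winningRegion O i := fun i a ha =>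
    let ⟨S, _, hS⟩ := hwin i
    ⟨S, hS a ha⟩
  have hdisj := Set.disjoint_left.1 (disjoint_winningRegion O)
  -- A vertex outside `W i` lies in the other set, hence in the winning region of the other player.
  have hsup : ∀ i, winningRegion O i ⊆ W i := by
    intro i a ha
    obtain ⟨k, hk⟩ := hcover a
    by_cases hki : k = i
    · exact hki ▸ hk
    · have hk' := hsub k hk
      have : i = 0 ∧ k = 1 ∨ i = 1 ∧ k = 0 := by omega
      obtain ⟨rfl, rfl⟩ | ⟨rfl, rfl⟩ := this
      · exact (hdisj ha hk').elim
      · exact (hdisj hk' ha).elim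
  refine ⟨⟨disjoint_winningRegion O, Set.eq_univ_of_forall fun a => ?_⟩, fun i => ?_⟩
  · obtain ⟨k, hk⟩ := hcover a
    have : k = 0 ∨ k = 1 := by omega
    obtain rfl | rfl := this
    · exact .inl (hsub 0 hk)
    · exact .inr (hsub 1 hk)
  · obtain ⟨S, hm, hS⟩ := hwin i
    exact ⟨S, hm, fun a ha => hS a (hsup i ha)⟩

theorem suffix_zero (π : A.Play) : π.suffix 0 = π :=
  Subtype.ext (funext fun j => congrArg π.1 (zero_add j))

/-- It suffices that player `0` wins the plays all of whose suffixes decompose into cycles in `Y`,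
and player `1` those all of whose suffixes decompose into cycles outside of `Y`. -/
theorem uniformMemorylessDetermined_of_suffixes [Finite V] {Y : CycleProperty U}
    (hcyc : ClosedUnderCyclicPerm Y) (hY : ClosedUnderConcat Y) (hYc : ClosedUnderConcat Yᶜ)
    {O : Set A.Play} (h0 : ∀ π : A.Play, (∀ n, π.suffix n ∈ A.allCycles Y) → π ∈ O)
    (h1 : ∀ π : A.Play, (∀ n, π.suffix n ∈ A.allCycles Yᶜ) → π ∉ O) :
    UniformMemorylessDetermined O := by
  -- The default label in `pairLabel` exists once there is an edge, hence once there is a vertex.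
  rcases isEmpty_or_nonempty V with hV | ⟨⟨v⟩⟩
  · exact uniformMemorylessDetermined_of_cover (W := fun _ => ∅) (fun a => hV.elim a) fun i =>
      ⟨⟨fun _ v => hV.elim v.1, fun _ v => hV.elim v.1⟩, fun _ _ v => hV.elim v.1, by simp⟩
  have : Nonempty U := let ⟨w, hw⟩ := A.no_dead_end v; ⟨A.label ⟨_, hw⟩⟩
  let C : Fin 2 → CycleProperty U := fun i => if i = 0 then Y else Yᶜ
  have hC : ∀ i j, i ≠ j → C j = (C i)ᶜ := by
    intro i j hij
    have : i = 0 ∧ j = 1 ∨ i = 1 ∧ j = 0 := by omega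
    obtain ⟨rfl, rfl⟩ | ⟨rfl, rfl⟩ := this <;> simp [C]
  obtain ⟨S⟩ := nonempty_solution (lab := A.pairLabel) (owner := A.owner) (C := C)
    (F := fun a b => (a, b) ∈ A.E)
    (fun i j hij u hu => by simpa [hC i j hij] using hu)
    (fun i j hij u hu => by simpa [hC i j hij] using hu)
    (fun i => by by_cases h : i = 0 <;> simp [C, h, hcyc, hcyc.compl])
    (fun i => by by_cases h : i = 0 <;> simp [C, h, hY, hYc])
    A.no_dead_end
  refine uniformMemorylessDetermined_of_cover S.cover fun i =>
    ⟨⟨fun _ v => S.σ i v.1, fun _ v => S.legal i v.1⟩, fun _ _ _ => rfl, ?_⟩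
  rintro a ha π rfl hcons
  have hstep : ∀ k, Step A.owner (fun a b => (a, b) ∈ A.E) i (S.σ i) (π.vertex k)
      (π.vertex (k + 1)) := fun k => ⟨π.2 k, fun h => hcons k h⟩
  have hreach : ∀ k, ReflTransGen (Step A.owner (fun a b => (a, b) ∈ A.E) i (S.σ i))
      (π.vertex 0) (π.vertex k) := by
    intro k
    induction k with
    | zero => exact .refl
    | succ k ih => exact ih.tail (hstep k)
  have hsuff : ∀ n, π.suffix n ∈ A.allCycles (C i) := fun n =>
    map_label_mem_of_good (π := π.suffix n) (fun k => hstep (n + k))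
      ((S.good i _ ha).of_reachable (hreach n))
  unfold WonBy
  by_cases hi : i = 0
  · simp only [C, hi, if_true] at hsuff ⊢
    exact h0 π hsuff
  · simp only [C, hi, if_false] at hsuff ⊢
    exact h1 π hsuff

/-- At least one cycle is output, so the two conditions cannot both hold vacuously. -/
theorem notMem_allCycles_of_compl [Finite V] {Y : CycleProperty U} {π : A.Play}
    (h : π ∈ A.allCycles Yᶜ) : π ∉ A.allCycles Y := fun h' =>
  let ⟨u, hu⟩ := π.cycles_nonempty
  h u hu (h' u hu)

end Arena

end CycleGames

theorem mainTheorem1 {V U : Type*} [Finite V] [Nonempty V]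
    (Y : CycleGames.CycleProperty U)
    (hcyc : CycleGames.ClosedUnderCyclicPerm Y)
    (hY : CycleGames.ClosedUnderConcat Y)
    (hYc : CycleGames.ClosedUnderConcat Yᶜ)
    (A : CycleGames.Arena V U) :
    (∀ W : Set (ℕ → U), A.GreedyOn Y W →
        CycleGames.Arena.UniformMemorylessDetermined (A.objective W)) ∧
      CycleGames.Arena.UniformMemorylessDetermined (A.suffixAllCycles Y) ∧
      CycleGames.Arena.UniformMemorylessDetermined (A.allCycles Y) := by
  open CycleGames.Arena in
  refine ⟨fun W hW => uniformMemorylessDetermined_of_suffixes hcyc hY hYc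
      (fun π h => hW.1 (suffix_zero π ▸ h 0)) (fun π h => hW.2 (suffix_zero π ▸ h 0)),
    uniformMemorylessDetermined_of_suffixes hcyc hY hYc (fun π h => ⟨0, h 0⟩) ?_,
    uniformMemorylessDetermined_of_suffixes hcyc hY hYc (fun π h => suffix_zero π ▸ h 0)
      (fun π h => notMem_allCycles_of_compl (suffix_zero π ▸ h 0))⟩
  -- The suffix witnessing membership in the objective itself has all its cycles outside `Y`.
  rintro π h ⟨n, hn⟩
  exact notMem_allCycles_of_compl (h n) hn
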